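/- **Theorem 2.2.** Let $f$ be a transcendental entire function and, for $r\ge 0$, put $M(r)=\max_{|z|=r}|f(z)|$ and $m(r)=\min_{|z|=r}|f(z)|$; let $m^n$ denote the $n$-th iterate of the function $m$. Suppose that $f$ has order $1/2$, minimal type, that is, $$\limsup_{r\to\infty}\frac{\log\log M(r)}{\log r}=\frac12\quad\text{and}\quad \lim_{r\to\infty}\frac{\log M(r)}{r^{1/2}}=0 .$$ Let $\varepsilon(r)$ and $k(r)$, $r>0$, be real functions such that $\log M(r)=r^{1/2-\varepsilon(r)}$ for all sufficiently large $r$, and $k(r)=\varepsilon(r)\log r$. Then there exists $r>0$ such that $m^n(r)\to\infty$ as $n\to\infty$ if either of the following statements holds: (a) there exist $\delta\in(0,1/2)$, $C>1$ and $r_1>0$ such that $$\delta\log r\ \ge\ k(r)\ \ge\ C\,\frac{\delta}{1/2-\delta}\,\log\log r\quad\text{for all } r>r_1;$$ (b) $\varepsilon(r)\to0$ as $r\to\infty$, and there exist $C,d>1$ and $r_2>0$ such that $$k(r)\ \ge\ C\,k\big((\log r)^{2d}\big)\quad\text{for all } r>r_2 .$$ -/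

import Mathlib

open Filter Topology

/-- An entire function is transcendental if it is not a polynomial function. -/
def IsTranscendentalEntire (f : ℂ → ℂ) : Prop :=
  Differentiable ℂ f ∧ ¬ ∃ p : Polynomial ℂ, ∀ z, f z = p.eval z

/-- The maximum modulus `M(r) = max_{|z| = r} |f(z)|`. For continuous `f` and `r ≥ 0` the circle is
compact and non-empty, so that the supremum is a maximum. -/
noncomputable def maxModulus (f : ℂ → ℂ) (r : ℝ) : ℝ :=
  sSup ((fun z : ℂ => ‖f z‖) '' Metric.sphere 0 r)

/-- The minimum modulus `m(r) = min_{|z| = r} |f(z)|`. For continuous `f` and `r ≥ 0` the circle is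
compact and non-empty, so that the infimum is a minimum. -/
noncomputable def minModulus (f : ℂ → ℂ) (r : ℝ) : ℝ :=
  sInf ((fun z : ℂ => ‖f z‖) '' Metric.sphere 0 r)

/-- The order `ρ(f) = limsup_{r → ∞} log log M(r) / log r`, an extended real number. -/
noncomputable def entireOrder (f : ℂ → ℂ) : EReal :=
  limsup (fun r : ℝ => ((Real.log (Real.log (maxModulus f r)) / Real.log r : ℝ) : EReal)) atTop

/-- Order `1/2`, minimal type: `ρ(f) = 1/2` and `log M(r) / r^{1/2} → 0`. -/
def IsOrderHalfMinimalType (f : ℂ → ℂ) : Prop :=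
  entireOrder f = ((1 / 2 : ℝ) : EReal) ∧
    Tendsto (fun r : ℝ => Real.log (maxModulus f r) / r ^ (1 / 2 : ℝ)) atTop (𝓝 0)

open Filter Topology

/-! It is enough that for every large `R` some `s ≤ R` has `m(s) > R`: the running maximum of `m`
then exceeds the identity, and nested compact sets give an escaping orbit
(`exists_tendsto_iterate_atTop`).

If instead `m ≤ R` on `[0, R]`, the Beurling–Nevanlinna estimate gives `log M(s) ≤ 2 √(s/R) log M(R)
+ log R` for `s < R` (`log_maxModulus_le`). Since `log M(r) = r^{1/2} e^{-k(r)}`, the first term on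
the right is `2 e^{k(s) - k(R)} log M(s)`. With `s = (log R)^p`, a contradiction follows once `k(R)
- k(s) ≥ 2` and `log R ≤ e^{-2} log M(s)`; each of (a) and (b) allows a suitable `p`.

The estimate itself comes from a majorant with all its zeros on the negative radius, followed by a
two-constants argument in the slit disc. -/

/-! ### Blaschke factors of the unit disc -/

theorem sq_norm_sub_eq (a z : ℂ) :
    ‖z - a‖ ^ 2 = ‖z‖ ^ 2 + ‖a‖ ^ 2 - 2 * (starRingEnd ℂ a * z).re := by
  simp only [Complex.sq_norm, Complex.normSq_apply, Complex.sub_re, Complex.sub_im, Complex.mul_re,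
    Complex.conj_re, Complex.conj_im]
  ring

theorem sq_norm_one_sub_conj_mul (a z : ℂ) :
    ‖1 - starRingEnd ℂ a * z‖ ^ 2 =
      1 + (‖a‖ * ‖z‖) ^ 2 - 2 * (starRingEnd ℂ a * z).re := by
  rw [mul_pow]
  simp only [Complex.sq_norm, Complex.normSq_apply, Complex.sub_re, Complex.sub_im, Complex.mul_re,
    Complex.mul_im, Complex.conj_re, Complex.conj_im, Complex.one_re, Complex.one_im]
  ring

theorem one_sub_conj_mul_ne_zero {a z : ℂ} (ha : ‖a‖ < 1) (hz : ‖z‖ ≤ 1) :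
    1 - starRingEnd ℂ a * z ≠ 0 := by
  intro h
  have h1 : ‖starRingEnd ℂ a * z‖ = 1 := by rw [← sub_eq_zero.mp h, norm_one]
  rw [norm_mul, RCLike.norm_conj] at h1
  nlinarith [norm_nonneg a, norm_nonneg z]

/-- The Blaschke factor of the unit disc with zero `a`. -/
noncomputable def blaschke (a z : ℂ) : ℂ := (z - a) / (1 - starRingEnd ℂ a * z)

theorem abs_re_conj_mul_le (a z : ℂ) : |(starRingEnd ℂ a * z).re| ≤ ‖a‖ * ‖z‖ := by
  refine (Complex.abs_re_le_norm _).trans_eq ?_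
  rw [norm_mul, RCLike.norm_conj]

/-- After squaring and cross-multiplying, the difference of the two sides is `2 (Re(āz) + |a||z|)(1
- |z|²)(1 - |a|²)`. The bound is the modulus at `|z|` of the factor with zero `-|a|`; the lower
bound in `le_norm_blaschke` is its modulus at `-|z|`. -/
theorem norm_blaschke_le {a z : ℂ} (ha : ‖a‖ < 1) (hz : ‖z‖ ≤ 1) :
    ‖blaschke a z‖ ≤ (‖z‖ + ‖a‖) / (1 + ‖a‖ * ‖z‖) := by
  have hd := norm_pos_iff.mpr (one_sub_conj_mul_ne_zero ha hz)
  have h := abs_le.mp (abs_re_conj_mul_le a z)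
  have ha0 := norm_nonneg a
  have hz0 := norm_nonneg z
  rw [blaschke, norm_div, div_le_div_iff₀ hd (by positivity),
    ← sq_le_sq₀ (by positivity) (by positivity), mul_pow, mul_pow, sq_norm_sub_eq,
    sq_norm_one_sub_conj_mul]
  have := mul_nonneg (mul_nonneg (by linarith : 0 ≤ (starRingEnd ℂ a * z).re + ‖a‖ * ‖z‖)
    (by nlinarith : 0 ≤ 1 - ‖z‖ ^ 2)) (by nlinarith : 0 ≤ 1 - ‖a‖ ^ 2)
  linarith

theorem le_norm_blaschke {a z : ℂ} (ha : ‖a‖ < 1) (hz : ‖z‖ < 1) :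
    |‖a‖ - ‖z‖| / (1 - ‖a‖ * ‖z‖) ≤ ‖blaschke a z‖ := by
  have hd := norm_pos_iff.mpr (one_sub_conj_mul_ne_zero ha hz.le)
  have h := abs_le.mp (abs_re_conj_mul_le a z)
  have ha0 := norm_nonneg a
  have hz0 := norm_nonneg z
  have h1 : 0 < 1 - ‖a‖ * ‖z‖ := by nlinarith
  rw [blaschke, norm_div, div_le_div_iff₀ h1 hd,
    ← sq_le_sq₀ (by positivity) (by positivity), mul_pow, mul_pow, sq_norm_one_sub_conj_mul,
    sq_norm_sub_eq, sq_abs]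
  have := mul_nonneg (mul_nonneg (by linarith : 0 ≤ ‖a‖ * ‖z‖ - (starRingEnd ℂ a * z).re)
    (by nlinarith : 0 ≤ 1 - ‖z‖ ^ 2)) (by nlinarith : 0 ≤ 1 - ‖a‖ ^ 2)
  linarith

theorem norm_blaschke_le_one {a z : ℂ} (ha : ‖a‖ < 1) (hz : ‖z‖ ≤ 1) : ‖blaschke a z‖ ≤ 1 := by
  refine (norm_blaschke_le ha hz).trans ?_
  have ha0 := norm_nonneg a
  have hz0 := norm_nonneg z
  rw [div_le_one (by positivity)]
  nlinarith

theorem norm_blaschke_of_norm_eq_one {a z : ℂ} (ha : ‖a‖ < 1) (hz : ‖z‖ = 1) :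
    ‖blaschke a z‖ = 1 := by
  have hd := norm_pos_iff.mpr (one_sub_conj_mul_ne_zero ha hz.le)
  rw [blaschke, norm_div, div_eq_one_iff_eq hd.ne', ← sq_eq_sq₀ (norm_nonneg _) hd.le,
    sq_norm_sub_eq, sq_norm_one_sub_conj_mul, hz]
  ring

theorem differentiableAt_blaschke {a z : ℂ} (ha : ‖a‖ < 1) (hz : ‖z‖ ≤ 1) :
    DifferentiableAt ℂ (blaschke a) z := by
  unfold blaschke
  exact DifferentiableAt.div (by fun_prop) (by fun_prop) (one_sub_conj_mul_ne_zero ha hz)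

theorem norm_blaschke_neg_norm_of_nonneg (a z : ℂ) :
    ‖blaschke (-(‖a‖ : ℂ)) (‖z‖ : ℂ)‖ = (‖z‖ + ‖a‖) / (1 + ‖a‖ * ‖z‖) := by
  have h : blaschke (-(‖a‖ : ℂ)) (‖z‖ : ℂ) = (((‖z‖ + ‖a‖) / (1 + ‖a‖ * ‖z‖) : ℝ) : ℂ) := by
    simp [blaschke]
  rw [h, Complex.norm_real, Real.norm_of_nonneg (by positivity)]

theorem norm_blaschke_neg_norm_of_nonpos {a z : ℂ} (ha : ‖a‖ < 1) (hz : ‖z‖ < 1) :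
    ‖blaschke (-(‖a‖ : ℂ)) (-(‖z‖ : ℂ))‖ = |‖a‖ - ‖z‖| / (1 - ‖a‖ * ‖z‖) := by
  have h : blaschke (-(‖a‖ : ℂ)) (-(‖z‖ : ℂ)) = (((‖a‖ - ‖z‖) / (1 - ‖a‖ * ‖z‖) : ℝ) : ℂ) := by
    simp [blaschke]
    ring
  have h1 : 0 < 1 - ‖a‖ * ‖z‖ := by nlinarith [norm_nonneg a, norm_nonneg z]
  rw [h, Complex.norm_real, Real.norm_eq_abs, abs_div, abs_of_pos h1]

/-! ### Harnack's inequality -/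

/-- **Harnack's inequality** for the real part of a holomorphic function on the unit disc, under
the assumption that this real part is positive. -/
theorem abs_re_sub_re_zero_le {q : ℂ → ℂ} (hq : DifferentiableOn ℂ q (Metric.ball 0 1))
    (hpos : ∀ z, ‖z‖ < 1 → 0 < (q z).re) {z : ℂ} (hz : ‖z‖ < 1) :
    |(q z).re - (q 0).re| ≤ ‖z‖ * ((q z).re + (q 0).re) := by
  -- This Möbius map sends the right half-plane to the disc and `q 0` to `0`, so the Schwarz lemma
  -- gives `|w(z)| ≤ |z|`.
  set w : ℂ → ℂ := fun z => (q z - q 0) / (q z + starRingEnd ℂ (q 0)) with hw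
  have hq0 : 0 < (q 0).re := hpos 0 (by simp)
  have hden : ∀ z, ‖z‖ < 1 → q z + starRingEnd ℂ (q 0) ≠ 0 := by
    intro z hz h
    have := congrArg Complex.re h
    simp only [Complex.add_re, Complex.conj_re, Complex.zero_re] at this
    linarith [hpos z hz]
  have e1 : ∀ z, ‖q z - q 0‖ ^ 2 =
      ((q z).re - (q 0).re) ^ 2 + ((q z).im - (q 0).im) ^ 2 := by
    intro z
    simp only [Complex.sq_norm, Complex.normSq_apply, Complex.sub_re, Complex.sub_im]
    ring
  have e2 : ∀ z, ‖q z + starRingEnd ℂ (q 0)‖ ^ 2 =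
      ((q z).re + (q 0).re) ^ 2 + ((q z).im - (q 0).im) ^ 2 := by
    intro z
    simp only [Complex.sq_norm, Complex.normSq_apply, Complex.add_re, Complex.add_im,
      Complex.conj_re, Complex.conj_im]
    ring
  have hwd : DifferentiableOn ℂ w (Metric.ball 0 1) :=
    (hq.sub_const _).div (hq.add_const _) fun x hx => hden x (by simpa using hx)
  have hw0 : w 0 = 0 := by simp [hw]
  have hmaps : Set.MapsTo w (Metric.ball 0 1) (Metric.closedBall (w 0) 1) := by
    intro x hx
    have hx' : ‖x‖ < 1 := by simpa using hx
    rw [hw0, mem_closedBall_zero_iff, hw]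
    simp only [norm_div]
    rw [div_le_one (norm_pos_iff.mpr (hden x hx')), ← sq_le_sq₀ (norm_nonneg _) (norm_nonneg _),
      e1, e2]
    nlinarith [hpos x hx']
  have hS := Complex.dist_le_dist_of_mapsTo_ball hwd hmaps (z := z) (by simpa using hz)
  rw [hw0, dist_zero_right, dist_zero_right, hw] at hS
  simp only [norm_div] at hS
  rw [div_le_iff₀ (norm_pos_iff.mpr (hden z hz)),
    ← sq_le_sq₀ (norm_nonneg _) (by positivity), mul_pow, e1, e2] at hS
  have h1 : 0 < (q z).re + (q 0).re := by linarith [hpos z hz]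
  have h2 : ‖z‖ ^ 2 ≤ 1 := by nlinarith [norm_nonneg z]
  refine abs_le_of_sq_le_sq ?_ (by positivity)
  nlinarith [mul_nonneg (sub_nonneg.mpr h2) (sq_nonneg ((q z).im - (q 0).im))]

/-- **Harnack's inequality** for the real part of a holomorphic function on the unit disc. -/
theorem re_mem_Icc_of_re_nonneg {q : ℂ → ℂ} (hq : DifferentiableOn ℂ q (Metric.ball 0 1))
    (hpos : ∀ z, ‖z‖ < 1 → 0 ≤ (q z).re) {z : ℂ} (hz : ‖z‖ < 1) :
    (q 0).re * ((1 - ‖z‖) / (1 + ‖z‖)) ≤ (q z).re ∧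
      (q z).re ≤ (q 0).re * ((1 + ‖z‖) / (1 - ‖z‖)) := by
  have key : |(q z).re - (q 0).re| ≤ ‖z‖ * ((q z).re + (q 0).re) := by
    -- Adding `e / 2` to `q` makes its real part strictly positive.
    refine le_of_forall_pos_le_add fun e he => ?_
    have := abs_re_sub_re_zero_le (q := fun z => q z + ((e / 2 : ℝ) : ℂ)) (hq.add_const _)
      (fun z hz => by simpa using add_pos_of_nonneg_of_pos (hpos z hz) (half_pos he)) hz
    simp only [Complex.add_re, Complex.ofReal_re] at this
    calc _ = |(q z).re + e / 2 - ((q 0).re + e / 2)| := by ring_nf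
      _ ≤ _ := this
      _ ≤ _ := by nlinarith
  obtain ⟨h1, h2⟩ := abs_le.mp key
  have hz0 := norm_nonneg z
  constructor
  · rw [mul_div_assoc', div_le_iff₀ (by positivity)]
    linarith
  · rw [mul_div_assoc', le_div_iff₀ (by linarith)]
    linarith

/-! ### Radial majorants -/

/-- `G` is a radial majorant of `F` on the unit disc: `G` is bounded by `1`, holomorphic up to the
boundary except at `-1`, and compares with `F` from below on the negative radius and from above on
the positive radius. -/
structure IsRadialMajorant (F G : ℂ → ℂ) : Prop where
  differentiableAt : ∀ z, ‖z‖ ≤ 1 → z ≠ -1 → DifferentiableAt ℂ G z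
  norm_le_one : ∀ z, ‖z‖ ≤ 1 → z ≠ -1 → ‖G z‖ ≤ 1
  neg_le : ∀ z, ‖z‖ < 1 → ‖G (-(‖z‖ : ℂ))‖ ≤ ‖F z‖
  le_pos : ∀ z, ‖z‖ < 1 → ‖F z‖ ≤ ‖G (‖z‖ : ℂ)‖

theorem IsRadialMajorant.blaschke_mul {F G : ℂ → ℂ} (h : IsRadialMajorant F G) {a : ℂ}
    (ha : ‖a‖ < 1) :
    IsRadialMajorant (fun z => blaschke a z * F z)
      (fun z => blaschke (-(‖a‖ : ℂ)) z * G z) := by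
  have ha' : ‖(-(‖a‖ : ℂ))‖ < 1 := by simpa using ha
  refine ⟨fun z hz hz1 => (differentiableAt_blaschke ha' hz).mul (h.differentiableAt z hz hz1),
    fun z hz hz1 => ?_, fun z hz => ?_, fun z hz => ?_⟩
  · rw [norm_mul]
    exact mul_le_one₀ (norm_blaschke_le_one ha' hz) (norm_nonneg _) (h.norm_le_one z hz hz1)
  · rw [norm_mul, norm_mul, norm_blaschke_neg_norm_of_nonpos ha hz]
    exact mul_le_mul (le_norm_blaschke ha hz) (h.neg_le z hz) (norm_nonneg _) (norm_nonneg _)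
  · rw [norm_mul, norm_mul, norm_blaschke_neg_norm_of_nonneg]
    exact mul_le_mul (norm_blaschke_le ha hz.le) (h.le_pos z hz) (norm_nonneg _) (by positivity)

theorem IsRadialMajorant.blaschke_pow_mul {F G : ℂ → ℂ} (h : IsRadialMajorant F G) {a : ℂ}
    (ha : ‖a‖ < 1) (n : ℕ) :
    ∃ G', IsRadialMajorant (fun z => blaschke a z ^ n * F z) G' := by
  induction n with
  | zero => exact ⟨G, by simpa using h⟩
  | succ n ih =>
    obtain ⟨G', hG'⟩ := ih
    exact ⟨_, by simpa only [pow_succ', mul_assoc] using hG'.blaschke_mul ha⟩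

theorem re_cayley (z : ℂ) : ((1 - z) / (1 + z)).re = (1 - ‖z‖ ^ 2) / ‖1 + z‖ ^ 2 := by
  rw [Complex.div_re, ← add_div, Complex.sq_norm, Complex.sq_norm]
  congr 1
  simp only [Complex.normSq_apply, Complex.sub_re, Complex.sub_im, Complex.add_re,
    Complex.add_im, Complex.one_re, Complex.one_im]
  ring

/-- A zero-free holomorphic function on the unit disc is an exponential. -/
theorem exists_eq_exp_neg {F : ℂ → ℂ} (hF : DifferentiableOn ℂ F (Metric.ball 0 1))
    (h0 : ∀ z, ‖z‖ < 1 → F z ≠ 0) :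
    ∃ q : ℂ → ℂ, DifferentiableOn ℂ q (Metric.ball 0 1) ∧
      ∀ z, ‖z‖ < 1 → F z = Complex.exp (-q z) := by
  have h0' : ∀ z ∈ Metric.ball (0 : ℂ) 1, F z ≠ 0 := fun z hz => h0 z (by simpa using hz)
  have hd : DifferentiableOn ℂ (fun z => deriv F z / F z) (Metric.ball 0 1) :=
    (hF.deriv Metric.isOpen_ball).div hF h0'
  obtain ⟨L, hL0, hL⟩ := hd.isExactOn_ball.with_val_at 0 (Complex.log (F 0))
  have hder : ∀ z ∈ Metric.ball (0 : ℂ) 1,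
      HasDerivAt (fun z => F z * Complex.exp (-L z)) 0 z := by
    intro z hz
    have h1 := (hF.differentiableAt (Metric.isOpen_ball.mem_nhds hz)).hasDerivAt
    refine (h1.fun_mul ((hL z hz).fun_neg.cexp)).congr_deriv ?_
    have h2 : F z * (deriv F z / F z) = deriv F z := mul_div_cancel₀ _ (h0' z hz)
    linear_combination -Complex.exp (-L z) * h2
  refine ⟨fun z => -L z, fun z hz => (hL z hz).neg.differentiableAt.differentiableWithinAt,
    fun z hz => ?_⟩
  have hz' : z ∈ Metric.ball (0 : ℂ) 1 := by simpa using hz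
  have hc := Metric.isOpen_ball.is_const_of_deriv_eq_zero
    (convex_ball (0 : ℂ) 1).isPreconnected
    (fun w hw => (hder w hw).differentiableAt.differentiableWithinAt)
    (fun w hw => (hder w hw).deriv) hz' (Metric.mem_ball_self one_pos)
  simp only [hL0] at hc
  rw [Complex.exp_neg (Complex.log _), Complex.exp_log (h0 0 (by simp)),
    mul_inv_cancel₀ (h0 0 (by simp)), Complex.exp_neg] at hc
  rw [neg_neg]
  exact (mul_inv_eq_one₀ (Complex.exp_ne_zero _)).mp hc

/-- Write `F = exp(-q)` with `Re q ≥ 0`. The Harnack bounds for `Re q` are the values of `Re q(0) ·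
(1 - z)/(1 + z)` at `±|z|`, so this function serves as the exponent of `G`; its possible pole is why
`-1` is excluded. -/
theorem exists_isRadialMajorant_of_ne_zero {F : ℂ → ℂ}
    (hF : DifferentiableOn ℂ F (Metric.ball 0 1))
    (h1 : ∀ z, ‖z‖ ≤ 1 → ‖F z‖ ≤ 1) (h0 : ∀ z, ‖z‖ < 1 → F z ≠ 0) :
    ∃ G, IsRadialMajorant F G := by
  obtain ⟨q, hq, hFq⟩ := exists_eq_exp_neg hF h0
  have hnorm : ∀ z, ‖z‖ < 1 → ‖F z‖ = Real.exp (-(q z).re) := fun z hz => by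
    rw [hFq z hz, Complex.norm_exp, Complex.neg_re]
  have hre : ∀ z, ‖z‖ < 1 → 0 ≤ (q z).re := fun z hz => by
    have := h1 z hz.le
    rw [hnorm z hz, Real.exp_le_one_iff] at this
    linarith
  have hG : ∀ z : ℂ, ‖Complex.exp (-(((q 0).re : ℂ) * ((1 - z) / (1 + z))))‖ =
      Real.exp (-((q 0).re * ((1 - z) / (1 + z)).re)) := fun z => by
    rw [Complex.norm_exp, Complex.neg_re, Complex.re_ofReal_mul]
  have hreal : ∀ t : ℝ, ((1 - (t : ℂ)) / (1 + (t : ℂ))).re = (1 - t) / (1 + t) := fun t => by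
    rw [← Complex.ofReal_one, ← Complex.ofReal_sub, ← Complex.ofReal_add, ← Complex.ofReal_div,
      Complex.ofReal_re]
  refine ⟨fun z => Complex.exp (-(((q 0).re : ℂ) * ((1 - z) / (1 + z)))),
    fun z hz hz1 => ?_, fun z hz hz1 => ?_, fun z hz => ?_, fun z hz => ?_⟩
  · have : 1 + z ≠ 0 := fun h => hz1 (by linear_combination h)
    fun_prop (disch := assumption)
  · rw [hG, Real.exp_le_one_iff, neg_nonpos, re_cayley]
    have : ‖z‖ ^ 2 ≤ 1 := by nlinarith [norm_nonneg z]
    exact mul_nonneg (hre 0 (by simp)) (div_nonneg (by linarith) (by positivity))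
  · rw [hG, hnorm z hz, Real.exp_le_exp, neg_le_neg_iff, ← Complex.ofReal_neg, hreal]
    simpa [← sub_eq_add_neg] using (re_mem_Icc_of_re_nonneg hq hre hz).2
  · rw [hG, hnorm z hz, Real.exp_le_exp, neg_le_neg_iff, hreal]
    exact (re_mem_Icc_of_re_nonneg hq hre hz).1

/-- Split off the zero of an entire function at `a`. -/
theorem exists_eq_sub_pow_mul {F : ℂ → ℂ} (hF : Differentiable ℂ F) (hne : ∃ z, F z ≠ 0) (a : ℂ) :
    ∃ (n : ℕ) (H : ℂ → ℂ), Differentiable ℂ H ∧ H a ≠ 0 ∧ ∀ z, F z = (z - a) ^ n * H z := by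
  have hnot : ¬ ∀ᶠ z in 𝓝 a, F z = 0 := by
    intro h
    obtain ⟨z, hz⟩ := hne
    exact hz ((hF.differentiableOn.analyticOnNhd
      isOpen_univ).eqOn_zero_of_preconnected_of_eventuallyEq_zero
      isPreconnected_univ (Set.mem_univ a) h (Set.mem_univ z))
  obtain ⟨n, g, hg, hga, hFg⟩ :=
    (hF.analyticAt a).exists_eventuallyEq_pow_smul_nonzero_iff.mpr hnot
  refine ⟨n, Function.update (fun z => F z / (z - a) ^ n) a (g a), fun z => ?_, by simpa using hga,
    fun z => ?_⟩
  · rcases eq_or_ne z a with rfl | hz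
    · refine hg.differentiableAt.congr_of_eventuallyEq ?_
      filter_upwards [hFg] with w hw
      rcases eq_or_ne w z with rfl | hwz
      · simp
      · rw [Function.update_of_ne hwz, hw, smul_eq_mul,
          mul_div_cancel_left₀ _ (pow_ne_zero _ (sub_ne_zero.mpr hwz))]
    · have h1 : DifferentiableAt ℂ (fun z => F z / (z - a) ^ n) z :=
        (hF z).div (by fun_prop) (pow_ne_zero _ (sub_ne_zero.mpr hz))
      refine h1.congr_of_eventuallyEq ?_
      filter_upwards [isOpen_ne.mem_nhds hz] with w hw
      exact Function.update_of_ne hw _ _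
  · rcases eq_or_ne z a with rfl | hz
    · simpa using hFg.self_of_nhds
    · rw [Function.update_of_ne hz, mul_div_cancel₀ _ (pow_ne_zero _ (sub_ne_zero.mpr hz))]

theorem finite_zeros_ball {F : ℂ → ℂ} (hF : Differentiable ℂ F) (hne : ∃ z, F z ≠ 0) :
    {z | ‖z‖ < 1 ∧ F z = 0}.Finite := by
  by_contra hinf
  obtain ⟨x, -, hx⟩ := Set.Infinite.exists_accPt_of_subset_isCompact hinf
    (isCompact_closedBall (0 : ℂ) 1) fun z hz => by simpa using hz.1.le
  obtain ⟨z, hz⟩ := hne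
  refine hz ((hF.differentiableOn.analyticOnNhd
    isOpen_univ).eqOn_zero_of_preconnected_of_frequently_eq_zero
    isPreconnected_univ (Set.mem_univ x) ?_ (Set.mem_univ z))
  exact (accPt_iff_frequently_nhdsNE.mp hx).mono fun w hw => hw.2

/-- Induction on the number of distinct zeros in the disc. Dividing out a Blaschke power keeps the
bound `1`, by the maximum principle, since the power has modulus `1` on the circle. -/
theorem exists_isRadialMajorant {F : ℂ → ℂ} (hF : Differentiable ℂ F) (hne : ∃ z, F z ≠ 0)
    (h1 : ∀ z, ‖z‖ ≤ 1 → ‖F z‖ ≤ 1) : ∃ G, IsRadialMajorant F G := by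
  induction hN : {z | ‖z‖ < 1 ∧ F z = 0}.ncard using Nat.strong_induction_on generalizing F with
  | _ N ih =>
  by_cases h0 : ∀ z, ‖z‖ < 1 → F z ≠ 0
  · exact exists_isRadialMajorant_of_ne_zero hF.differentiableOn h1 h0
  push Not at h0
  obtain ⟨a, ha, hFa⟩ := h0
  obtain ⟨n, H, hH, hHa, hFH⟩ := exists_eq_sub_pow_mul hF hne a
  -- Written as a product, the quotient is entire, and the new factor has no zero in the closed
  -- disc.
  set F₁ : ℂ → ℂ := fun z => (1 - starRingEnd ℂ a * z) ^ n * H z with hF₁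
  have hF₁d : Differentiable ℂ F₁ := by fun_prop
  have hfac : ∀ z, ‖z‖ ≤ 1 → F z = blaschke a z ^ n * F₁ z := by
    intro z hz
    have := pow_ne_zero n (one_sub_conj_mul_ne_zero ha hz)
    rw [hFH, hF₁, blaschke, div_pow, ← mul_assoc, div_mul_cancel₀ _ this]
  have hF₁a : F₁ a ≠ 0 := mul_ne_zero (pow_ne_zero n (one_sub_conj_mul_ne_zero ha ha.le)) hHa
  have hbd : ∀ z, ‖z‖ ≤ 1 → ‖F₁ z‖ ≤ 1 := by
    intro z hz
    refine Complex.norm_le_of_forall_mem_frontier_norm_le (U := Metric.ball (0 : ℂ) 1)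
      Metric.isBounded_ball hF₁d.diffContOnCl (fun w hw => ?_) ?_
    · have hw1 : ‖w‖ = 1 := by
        rw [frontier_ball _ one_ne_zero] at hw
        simpa using hw
      have := h1 w hw1.le
      rwa [hfac w hw1.le, norm_mul, norm_pow, norm_blaschke_of_norm_eq_one ha hw1, one_pow,
        one_mul] at this
    · rw [closure_ball _ one_ne_zero]
      simpa using hz
  have hcard : {z | ‖z‖ < 1 ∧ F₁ z = 0}.ncard < N := by
    rw [← hN]
    refine Set.ncard_lt_ncard ⟨fun z hz => ⟨hz.1, ?_⟩, fun h => hF₁a (h ⟨ha, hFa⟩).2⟩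
      (finite_zeros_ball hF hne)
    rw [hfac z hz.1.le, hz.2, mul_zero]
  obtain ⟨G, hG⟩ := ih _ hcard hF₁d ⟨a, hF₁a⟩ hbd rfl
  obtain ⟨G', hG'⟩ := hG.blaschke_pow_mul ha n
  refine ⟨G', hG'.differentiableAt, hG'.norm_le_one, fun z hz => ?_, fun z hz => ?_⟩
  · rw [hfac z hz.le]
    exact hG'.neg_le z hz
  · rw [hfac z hz.le]
    exact hG'.le_pos z hz

/-! ### The slit disc and the Beurling–Nevanlinna estimate -/

theorem sq_norm_sin (z : ℂ) : ‖Complex.sin z‖ ^ 2 = Real.sin z.re ^ 2 + Real.sinh z.im ^ 2 := by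
  rw [Complex.sin_eq, ← Complex.ofReal_sin, ← Complex.ofReal_cosh, ← Complex.ofReal_cos,
    ← Complex.ofReal_sinh, ← Complex.ofReal_mul, ← Complex.ofReal_mul, Complex.sq_norm,
    Complex.normSq_add_mul_I, mul_pow, mul_pow, Real.cosh_sq, Real.cos_sq']
  ring

theorem sq_norm_cos (z : ℂ) : ‖Complex.cos z‖ ^ 2 = Real.cos z.re ^ 2 + Real.sinh z.im ^ 2 := by
  rw [Complex.cos_eq, ← Complex.ofReal_sin, ← Complex.ofReal_cosh, ← Complex.ofReal_cos,
    ← Complex.ofReal_sinh, ← Complex.ofReal_mul, ← Complex.ofReal_mul, Complex.sq_norm,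
    sub_eq_add_neg, ← neg_mul, ← Complex.ofReal_neg,
    Complex.normSq_add_mul_I, neg_sq, mul_pow, mul_pow, Real.cosh_sq, Real.sin_sq]
  ring

theorem cos_ne_zero_of_abs_re_lt {z : ℂ} (hz : |z.re| < Real.pi / 2) : Complex.cos z ≠ 0 := by
  have h := Real.cos_pos_of_mem_Ioo (abs_lt.mp hz)
  have := sq_norm_cos z
  intro h0
  rw [h0, norm_zero] at this
  nlinarith [sq_nonneg (Real.sinh z.im)]

theorem norm_tan_le_one {z : ℂ} (hz : z.re ∈ Set.Icc 0 (Real.pi / 4)) : ‖Complex.tan z‖ ≤ 1 := by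
  have hpi := Real.pi_pos
  have hc := cos_ne_zero_of_abs_re_lt (z := z)
    (by rw [abs_of_nonneg hz.1]; linarith [hz.2])
  rw [Complex.tan, norm_div, div_le_one (norm_pos_iff.mpr hc),
    ← sq_le_sq₀ (norm_nonneg _) (norm_nonneg _), sq_norm_sin, sq_norm_cos]
  have h1 : Real.sin z.re ≤ Real.sin (Real.pi / 4) :=
    Real.sin_le_sin_of_le_of_le_pi_div_two (by linarith [hz.1]) (by linarith) hz.2
  have h2 : Real.cos (Real.pi / 4) ≤ Real.cos z.re :=
    Real.cos_le_cos_of_nonneg_of_le_pi hz.1 (by linarith) hz.2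
  rw [Real.sin_pi_div_four] at h1
  rw [Real.cos_pi_div_four] at h2
  have h3 : 0 ≤ Real.sin z.re := Real.sin_nonneg_of_nonneg_of_le_pi hz.1 (by linarith [hz.2])
  nlinarith

theorem tan_sq_ne_neg_one {z : ℂ} (hz : Complex.cos z ≠ 0) : Complex.tan z ^ 2 ≠ -1 := by
  intro h
  rw [Complex.tan, div_pow, div_eq_iff (pow_ne_zero 2 hz)] at h
  exact one_ne_zero (by linear_combination (-1 : ℂ) * Complex.sin_sq_add_cos_sq z + h : (1 : ℂ) = 0)

open Complex.HadamardThreeLines in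
/-- The **two-constants estimate** for the unit disc slit along the negative radius. -/
theorem norm_le_rpow_of_slit {G : ℂ → ℂ}
    (hd : ∀ z, ‖z‖ ≤ 1 → z ≠ -1 → DifferentiableAt ℂ G z)
    (hG : ∀ z, ‖z‖ ≤ 1 → z ≠ -1 → ‖G z‖ ≤ 1) {η : ℝ}
    (hη : ∀ t : ℝ, 0 ≤ t → t < 1 → ‖G (-(t : ℂ))‖ ≤ η) {s : ℝ} (hs : 0 ≤ s) (hs1 : s < 1) :
    ‖G s‖ ≤ η ^ (1 - 4 / Real.pi * Real.arctan √s) := by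
  have hpi := Real.pi_pos
  -- The map `tan²(πw/4)` sends the strip `0 ≤ Re w ≤ 1` into the closed disc without `-1`, and the
  -- line `Re w = 0` into the slit `(-1, 0]`. The three lines theorem thus applies to `G ∘ φ`, with
  -- bounds `η` and `1`, at the preimage `x` of `s`.
  set φ : ℂ → ℂ := fun w => Complex.tan (((Real.pi / 4 : ℝ) : ℂ) * w) ^ 2 with hφ
  have hre : ∀ w ∈ verticalClosedStrip 0 1,
      (((Real.pi / 4 : ℝ) : ℂ) * w).re ∈ Set.Icc 0 (Real.pi / 4) := by
    intro w hw
    rw [Complex.re_ofReal_mul]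
    exact ⟨mul_nonneg (by positivity) hw.1, mul_le_of_le_one_right (by positivity) hw.2⟩
  have hcos : ∀ w ∈ verticalClosedStrip 0 1, Complex.cos (((Real.pi / 4 : ℝ) : ℂ) * w) ≠ 0 := by
    intro w hw
    have := hre w hw
    exact cos_ne_zero_of_abs_re_lt (by rw [abs_of_nonneg this.1]; linarith [this.2])
  have hφ1 : ∀ w ∈ verticalClosedStrip 0 1, ‖φ w‖ ≤ 1 := by
    intro w hw
    rw [hφ, norm_pow]
    exact pow_le_one₀ (norm_nonneg _) (norm_tan_le_one (hre w hw))
  have hφ2 : ∀ w ∈ verticalClosedStrip 0 1, φ w ≠ -1 := fun w hw =>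
    tan_sq_ne_neg_one (hcos w hw)
  have hdiff : DifferentiableOn ℂ (fun w => G (φ w)) (verticalClosedStrip 0 1) := by
    intro w hw
    have h1 : DifferentiableAt ℂ φ w :=
      ((Complex.differentiableAt_tan.mpr (hcos w hw)).comp w (by fun_prop :
        DifferentiableAt ℂ (fun w => ((Real.pi / 4 : ℝ) : ℂ) * w) w)).pow 2
    exact ((hd _ (hφ1 w hw) (hφ2 w hw)).comp w h1).differentiableWithinAt
  have hcl : closure (verticalStrip 0 1) ⊆ verticalClosedStrip 0 1 :=
    closure_minimal (Set.preimage_mono Set.Ioo_subset_Icc_self)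
      (isClosed_Icc.preimage Complex.continuous_re)
  have hat : 0 ≤ Real.arctan √s := Real.arctan_nonneg.mpr (Real.sqrt_nonneg s)
  have hat1 : Real.arctan √s ≤ Real.pi / 4 := by
    rw [← Real.arctan_one, Real.arctan_le_arctan_iff]
    exact Real.sqrt_le_one.mpr hs1.le
  set x : ℝ := 4 / Real.pi * Real.arctan √s with hx
  have hx0 : 0 ≤ x := by positivity
  have hx1 : x ≤ 1 := by
    rw [hx, div_mul_eq_mul_div, div_le_one hpi]
    linarith
  have h := norm_le_interp_of_mem_verticalClosedStrip₀₁' (fun w => G (φ w)) (z := (x : ℂ))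
    (a := η) (b := 1) ⟨by simpa using hx0, by simpa using hx1⟩ (hdiff.mono hcl).diffContOnCl
    ⟨1, by rintro _ ⟨w, hw, rfl⟩; exact hG _ (hφ1 w hw) (hφ2 w hw)⟩ ?_ ?_
  · have hφx : φ x = s := by
      rw [hφ]
      simp only
      rw [← Complex.ofReal_mul, ← Complex.ofReal_tan, hx, ← mul_assoc,
        div_mul_div_cancel₀ (by norm_num), div_self hpi.ne', one_mul, Real.tan_arctan,
        ← Complex.ofReal_pow, Real.sq_sqrt hs]
    simpa [hφx] using h
  · intro w hw
    have hw' : w = (w.im : ℂ) * Complex.I := by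
      apply Complex.ext <;> simp
      simpa using hw
    have hφw : φ w = -((Real.tanh (Real.pi / 4 * w.im) ^ 2 : ℝ) : ℂ) := by
      rw [hφ]
      simp only
      rw [hw', ← mul_assoc, ← Complex.ofReal_mul, Complex.tan_mul_I, mul_pow, Complex.I_sq]
      simp
    rw [hφw]
    exact hη _ (sq_nonneg _) ((sq_lt_one_iff_abs_lt_one _).mpr (Real.abs_tanh_lt_one _))
  · intro w hw
    have hw' : w ∈ verticalClosedStrip 0 1 := by
      have : w.re = 1 := by simpa using hw
      constructor <;> simp [this]
    exact hG _ (hφ1 w hw') (hφ2 w hw')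

/-- The **Beurling–Nevanlinna estimate** for an entire function which is bounded by `1` on the
unit disc and whose minimum modulus is at most `η` there. -/
theorem norm_le_rpow_of_forall_exists_norm_le {F : ℂ → ℂ} (hF : Differentiable ℂ F)
    (hne : ∃ z, F z ≠ 0) (h1 : ∀ z, ‖z‖ ≤ 1 → ‖F z‖ ≤ 1) {η : ℝ}
    (hη : ∀ t : ℝ, 0 ≤ t → t < 1 → ∃ z, ‖z‖ = t ∧ ‖F z‖ ≤ η) {z : ℂ} (hz : ‖z‖ < 1) :
    ‖F z‖ ≤ η ^ (1 - 4 / Real.pi * Real.arctan √‖z‖) := by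
  obtain ⟨G, hG⟩ := exists_isRadialMajorant hF hne h1
  refine (hG.le_pos z hz).trans (norm_le_rpow_of_slit hG.differentiableAt hG.norm_le_one
    (fun t ht ht1 => ?_) (norm_nonneg z) hz)
  obtain ⟨w, rfl, hw⟩ := hη t ht ht1
  exact (hG.neg_le w ht1).trans hw

/-! ### Growth of the maximum modulus when the minimum modulus is small -/

theorem isCompact_image_norm_sphere {f : ℂ → ℂ} (hf : Continuous f) (r : ℝ) :
    IsCompact ((fun z : ℂ => ‖f z‖) '' Metric.sphere 0 r) :=
  (isCompact_sphere 0 r).image hf.norm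

theorem nonempty_image_norm_sphere (f : ℂ → ℂ) {r : ℝ} (hr : 0 ≤ r) :
    ((fun z : ℂ => ‖f z‖) '' Metric.sphere 0 r).Nonempty :=
  (NormedSpace.sphere_nonempty.mpr hr).image _

theorem norm_le_maxModulus {f : ℂ → ℂ} (hf : Continuous f) (z : ℂ) :
    ‖f z‖ ≤ maxModulus f ‖z‖ :=
  le_csSup (isCompact_image_norm_sphere hf _).bddAbove ⟨z, by simp, rfl⟩

theorem exists_norm_eq_maxModulus {f : ℂ → ℂ} (hf : Continuous f) {r : ℝ} (hr : 0 ≤ r) :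
    ∃ z, ‖z‖ = r ∧ ‖f z‖ = maxModulus f r := by
  obtain ⟨z, hz, h⟩ := (isCompact_image_norm_sphere hf r).sSup_mem
    (nonempty_image_norm_sphere f hr)
  exact ⟨z, by simpa using hz, h⟩

theorem exists_norm_eq_minModulus {f : ℂ → ℂ} (hf : Continuous f) {r : ℝ} (hr : 0 ≤ r) :
    ∃ z, ‖z‖ = r ∧ ‖f z‖ = minModulus f r := by
  obtain ⟨z, hz, h⟩ := (isCompact_image_norm_sphere hf r).sInf_mem
    (nonempty_image_norm_sphere f hr)
  exact ⟨z, by simpa using hz, h⟩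

/-- If the minimum modulus of an entire function does not exceed `R` on `[0, R)`, then the
logarithm of its maximum modulus is small on smaller circles. -/
theorem log_maxModulus_le {f : ℂ → ℂ} (hf : Differentiable ℂ f) {R s : ℝ} (hR : 1 ≤ R)
    (hs : 0 ≤ s) (hsR : s < R) (hM : 1 ≤ maxModulus f R) (hMs : 0 < maxModulus f s)
    (hmin : ∀ t : ℝ, 0 ≤ t → t < R → minModulus f t ≤ R) :
    Real.log (maxModulus f s) ≤ 2 * √(s / R) * Real.log (maxModulus f R) + Real.log R := by
  have hR0 : 0 < R := by linarith
  have hM0 : 0 < maxModulus f R := by linarith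
  -- Rescaled to the unit disc, the bound `m ≤ R` becomes `η = R / M(R)`.
  set F : ℂ → ℂ := fun z => f ((R : ℂ) * z) / (maxModulus f R : ℂ) with hFdef
  have hFnorm : ∀ z, ‖F z‖ = ‖f ((R : ℂ) * z)‖ / maxModulus f R := fun z => by
    rw [hFdef, norm_div, Complex.norm_real, Real.norm_of_nonneg hM0.le]
  have hF : Differentiable ℂ F := by fun_prop
  have hRz : ∀ z : ℂ, ‖(R : ℂ) * z‖ = R * ‖z‖ := fun z => by
    rw [norm_mul, Complex.norm_real, Real.norm_of_nonneg hR0.le]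
  have hsphere : ∀ z, ‖z‖ = 1 → ‖F z‖ ≤ 1 := fun z hz => by
    rw [hFnorm, div_le_one hM0]
    have := norm_le_maxModulus hf.continuous ((R : ℂ) * z)
    rwa [hRz, hz, mul_one] at this
  have h1 : ∀ z, ‖z‖ ≤ 1 → ‖F z‖ ≤ 1 := fun z hz => by
    refine Complex.norm_le_of_forall_mem_frontier_norm_le (U := Metric.ball (0 : ℂ) 1)
      Metric.isBounded_ball hF.diffContOnCl (fun w hw => hsphere w ?_) ?_
    · rw [frontier_ball _ one_ne_zero] at hw
      simpa using hw
    · rw [closure_ball _ one_ne_zero]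
      simpa using hz
  obtain ⟨z, hzs, hz⟩ := exists_norm_eq_maxModulus hf.continuous hs
  have hRC : (R : ℂ) ≠ 0 := Complex.ofReal_ne_zero.mpr hR0.ne'
  have hzR : (R : ℂ) * (z / R) = z := mul_div_cancel₀ z hRC
  have hzn : ‖z / (R : ℂ)‖ = s / R := by
    rw [norm_div, Complex.norm_real, Real.norm_of_nonneg hR0.le, hzs]
  have hFz : ‖F (z / R)‖ = maxModulus f s / maxModulus f R := by rw [hFnorm, hzR, hz]
  have hsR' : s / R < 1 := (div_lt_one hR0).mpr hsR
  have key := norm_le_rpow_of_forall_exists_norm_le hF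
    ⟨z / R, norm_pos_iff.mp (hFz ▸ div_pos hMs hM0)⟩ h1 (η := R / maxModulus f R) (z := z / R)
    (fun t ht ht1 => by
      obtain ⟨w, hw, hfw⟩ := exists_norm_eq_minModulus hf.continuous (mul_nonneg hR0.le ht)
      refine ⟨w / R, ?_, ?_⟩
      · rw [norm_div, Complex.norm_real, Real.norm_of_nonneg hR0.le, hw,
          mul_div_cancel_left₀ _ hR0.ne']
      · rw [hFnorm, mul_div_cancel₀ w hRC, hfw]
        gcongr
        exact hmin _ (mul_nonneg hR0.le ht) (mul_lt_of_lt_one_right hR0 ht1))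
    (hzn ▸ hsR')
  rw [hFz, hzn] at key
  have hpi := Real.pi_pos
  set u : ℝ := √(s / R)
  have hu : 0 ≤ u := Real.sqrt_nonneg _
  have hat : 0 ≤ Real.arctan u := Real.arctan_nonneg.mpr hu
  have hat1 : Real.arctan u ≤ u := by
    have := Real.le_tan hat (Real.arctan_lt_pi_div_two u)
    rwa [Real.tan_arctan] at this
  have hω : 4 / Real.pi * Real.arctan u ≤ 2 * u := by
    have : 4 / Real.pi ≤ 2 := by
      rw [div_le_iff₀ hpi]
      linarith [Real.pi_gt_three]
    exact mul_le_mul this hat1 hat (by norm_num)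
  have hω0 : 0 ≤ 4 / Real.pi * Real.arctan u := by positivity
  generalize 4 / Real.pi * Real.arctan u = ω at key hω hω0
  have hlog := Real.log_le_log (div_pos hMs hM0) key
  rw [Real.log_rpow (div_pos hR0 hM0), Real.log_div hMs.ne' hM0.ne',
    Real.log_div hR0.ne' hM0.ne'] at hlog
  have hlR := Real.log_nonneg hR
  have hlM := Real.log_nonneg hM
  -- Here `hlog` reads `log M(s) ≤ ω log M(R) + (1 - ω) log R`, with `0 ≤ ω ≤ 2u`.
  nlinarith [mul_le_mul_of_nonneg_right hω hlM, mul_nonneg hω0 hlR]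

/-! ### Orbits escaping to infinity -/

/-- The points whose first `n` iterates follow the itinerary form a decreasing sequence of compact
sets. Each is nonempty because `φ^[n]` maps it onto `I n`, so Cantor's intersection theorem applies.
-/
theorem exists_forall_iterate_mem {X : Type*} [TopologicalSpace X] [T2Space X] {φ : X → X}
    (hφ : Continuous φ) {I : ℕ → Set X} (hI : ∀ n, IsCompact (I n)) (hne : ∀ n, (I n).Nonempty)
    (hsub : ∀ n, I (n + 1) ⊆ φ '' I n) : ∃ x, ∀ n, φ^[n] x ∈ I n := by
  set K : ℕ → Set X := fun n => {x | ∀ j ≤ n, φ^[j] x ∈ I j} with hK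
  have hclosed : ∀ n, IsClosed (K n) := fun n => by
    simp only [hK, Set.ofPred_forall]
    exact isClosed_iInter fun j => isClosed_iInter fun _ =>
      (hI j).isClosed.preimage (hφ.iterate j)
  have hsurj : ∀ n, I n ⊆ φ^[n] '' K n := by
    intro n
    induction n with
    | zero => exact fun x hx => ⟨x, fun j hj => by simpa [Nat.le_zero.mp hj] using hx, rfl⟩
    | succ n ih =>
      intro y hy
      obtain ⟨z, hz, rfl⟩ := hsub n hy
      obtain ⟨x, hx, rfl⟩ := ih hz
      rw [← Function.iterate_succ_apply' φ n x] at hy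
      refine ⟨x, fun j hj => ?_, Function.iterate_succ_apply' φ n x⟩
      rcases Nat.le_succ_iff.mp hj with h | rfl
      · exact hx j h
      · exact hy
  obtain ⟨x, hx⟩ := IsCompact.nonempty_iInter_of_sequence_nonempty_isCompact_isClosed K
    (fun n x hx j hj => hx j (hj.trans n.le_succ))
    (fun n => ((hne n).mono (hsurj n)).of_image)
    ((hI 0).of_isClosed_subset (hclosed 0) fun x hx => hx 0 le_rfl) hclosed
  exact ⟨x, fun n => Set.mem_iInter.mp hx n n le_rfl⟩

/-- If the running maximum of a continuous function exceeds the identity near infinity, then some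
orbit tends to infinity. -/
theorem exists_tendsto_iterate_atTop {φ : ℝ → ℝ} (hφ : Continuous φ) {R₀ : ℝ} (hR₀ : 0 < R₀)
    (h : ∀ r, R₀ ≤ r → ∃ s ∈ Set.Icc 0 r, r < φ s) :
    ∃ r, 0 < r ∧ Tendsto (fun n : ℕ => φ^[n] r) atTop atTop := by
  set ψ : ℝ → ℝ := fun r => sSup (φ '' Set.Icc 0 r) with hψ
  have hcomp : ∀ r, IsCompact (φ '' Set.Icc 0 r) := fun r => isCompact_Icc.image hφ
  have hle : ∀ r, ∀ s ∈ Set.Icc 0 r, φ s ≤ ψ r := fun r s hs =>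
    le_csSup (hcomp r).bddAbove ⟨s, hs, rfl⟩
  have hlt : ∀ r, R₀ ≤ r → r < ψ r := fun r hr => by
    obtain ⟨s, hs, hrs⟩ := h r hr
    exact hrs.trans_le (hle r s hs)
  have hatt : ∀ r, R₀ ≤ r → ∃ s ∈ Set.Icc 0 r, φ s = ψ r := fun r hr =>
    (hcomp r).sSup_mem ((Set.nonempty_Icc.mpr (hR₀.le.trans hr)).image φ)
  set R : ℕ → ℝ := fun n => ψ^[n] R₀ with hR
  have hRs : ∀ n, R (n + 1) = ψ (R n) := fun n => Function.iterate_succ_apply' ψ n R₀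
  have hR0 : ∀ n, R₀ ≤ R n := by
    intro n
    induction n with
    | zero => exact le_rfl
    | succ n ih => exact ih.trans ((hlt _ ih).le.trans_eq (hRs n).symm)
  have hRlt : ∀ n, R n < R (n + 1) := fun n => (hlt _ (hR0 n)).trans_eq (hRs n).symm
  have hmono : StrictMono R := strictMono_nat_of_lt_succ hRlt
  have hpos : ∀ n, 0 ≤ R n := fun n => hR₀.le.trans (hR0 n)
  have htop : Tendsto R atTop atTop := by
    -- At a finite limit `l` some `s ≤ l` has `φ s > l`. Once `R n` passes `s`, or comes close to it
    -- when `s = l`, the next term exceeds `l`.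
    refine (tendsto_atTop_of_monotone hmono.monotone).resolve_right ?_
    rintro ⟨l, hl⟩
    have hRl : ∀ n, R n ≤ l := fun n => hmono.monotone.ge_of_tendsto hl n
    obtain ⟨s, hs, hls⟩ := h l ((hR0 0).trans (hRl 0))
    rcases hs.2.lt_or_eq with hsl | rfl
    · obtain ⟨n, hn⟩ := (hl.eventually_const_lt hsl).exists
      have := (hle (R n) s ⟨hs.1, hn.le⟩).trans_eq (hRs n).symm
      linarith [hRl (n + 1)]
    · obtain ⟨n, hn⟩ := (((hφ.tendsto s).comp hl).eventually_const_lt hls).exists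
      have := (hle (R n) (R n) ⟨hpos n, le_rfl⟩).trans_eq (hRs n).symm
      have := hRl (n + 1)
      simp only [Function.comp_apply] at hn
      linarith
  choose S hS hφS using fun n => hatt (R n) (hR0 n)
  -- Otherwise the maximum `R (n + 2)` over `[0, R (n + 1)]` would already occur on `[0, R n]`,
  -- where `φ ≤ R (n + 1)`.
  have hRS : ∀ n, R n < S (n + 1) := fun n => by
    by_contra! hcon
    have := hle (R n) _ ⟨(hS (n + 1)).1, hcon⟩
    rw [hφS, ← hRs, ← hRs] at this
    exact absurd (hRlt (n + 1)) this.not_gt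
  -- Since `φ (R n) ≤ R (n + 1)` and `φ (S (n + 1)) = R (n + 2) ≥ S (n + 2)`, the intermediate value
  -- theorem makes each interval cover the next.
  obtain ⟨x, hx⟩ := exists_forall_iterate_mem hφ (I := fun n => Set.Icc (R n) (S (n + 1)))
    (fun n => isCompact_Icc) (fun n => Set.nonempty_Icc.mpr (hRS n).le) fun n => by
      refine subset_trans (fun y hy => ?_) (intermediate_value_Icc (hRS n).le hφ.continuousOn)
      refine ⟨((hle (R n) (R n) ⟨hpos n, le_rfl⟩).trans_eq (hRs n).symm).trans hy.1, ?_⟩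
      rw [hφS, ← hRs]
      exact hy.2.trans (hS (n + 2)).2
  exact ⟨x, (hR₀.trans_le (hR0 0)).trans_le (hx 0).1,
    tendsto_atTop_mono (fun n => (hx n).1) htop⟩

theorem minModulus_eq_sInf_unit_sphere (f : ℂ → ℂ) {r : ℝ} (hr : 0 ≤ r) :
    minModulus f r = sInf ((fun u : ℂ => ‖f ((r : ℂ) * u)‖) '' Metric.sphere 0 1) := by
  rw [minModulus]
  congr 1
  ext y
  constructor
  · rintro ⟨z, hz, rfl⟩
    have hz' : ‖z‖ = r := by simpa using hz
    rcases hr.eq_or_lt with rfl | hr'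
    · exact ⟨1, by simp, by simp [norm_eq_zero.mp hz']⟩
    · have hrC : (r : ℂ) ≠ 0 := Complex.ofReal_ne_zero.mpr hr'.ne'
      refine ⟨z / r, ?_, by simp only [mul_div_cancel₀ z hrC]⟩
      rw [mem_sphere_zero_iff_norm, norm_div, Complex.norm_real, Real.norm_of_nonneg hr, hz',
        div_self hr'.ne']
  · rintro ⟨u, hu, rfl⟩
    refine ⟨(r : ℂ) * u, ?_, rfl⟩
    rw [mem_sphere_zero_iff_norm] at hu ⊢
    rw [norm_mul, Complex.norm_real, Real.norm_of_nonneg hr, hu, mul_one]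

theorem minModulus_nonneg (f : ℂ → ℂ) (r : ℝ) : 0 ≤ minModulus f r :=
  Real.sInf_nonneg (by rintro _ ⟨z, -, rfl⟩; exact norm_nonneg _)

/-- An infimum over the fixed compact unit circle depends continuously on `r`. The clamp is needed
because a circle of negative radius is empty and has infimum `0`. -/
theorem continuous_minModulus_max {f : ℂ → ℂ} (hf : Continuous f) :
    Continuous fun r : ℝ => minModulus f (max 0 r) := by
  simp only [minModulus_eq_sInf_unit_sphere f (le_max_left _ _)]
  exact (isCompact_sphere (0 : ℂ) 1).continuous_sInf (by
    simp only [Function.HasUncurry.uncurry, id]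
    fun_prop)

theorem exists_tendsto_iterate_minModulus {f : ℂ → ℂ} (hf : Continuous f)
    (h : ∀ᶠ r : ℝ in atTop, ∃ s ∈ Set.Icc 0 r, r < minModulus f s) :
    ∃ r : ℝ, 0 < r ∧ Tendsto (fun n : ℕ => (minModulus f)^[n] r) atTop atTop := by
  obtain ⟨R₀, hR₀⟩ := eventually_atTop.mp h
  obtain ⟨r, hr, hlim⟩ := exists_tendsto_iterate_atTop (continuous_minModulus_max hf)
    (R₀ := max R₀ 1) (by positivity) fun r hr => by
      obtain ⟨s, hs, hrs⟩ := hR₀ r ((le_max_left _ _).trans hr)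
      exact ⟨s, hs, by rwa [max_eq_right hs.1]⟩
  refine ⟨r, hr, ?_⟩
  suffices ∀ n : ℕ, (fun r : ℝ => minModulus f (max 0 r))^[n] r = (minModulus f)^[n] r ∧
      0 ≤ (minModulus f)^[n] r by
    simpa only [fun n => (this n).1] using hlim
  intro n
  induction n with
  | zero => exact ⟨rfl, hr.le⟩
  | succ n ih =>
    rw [Function.iterate_succ_apply', Function.iterate_succ_apply', ih.1, max_eq_right ih.2]
    exact ⟨rfl, minModulus_nonneg f _⟩

/-! ### Comparing the scales `R` and `(log R)^p` -/

/-- Here `R = exp(exp q)` and `s = exp(pq) = (log R)^p`. The hypotheses `h1` and `h2` bound `√(s/R)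
log M(R)` and `log R` by `e^{-2} log M(s)`, and `2 + 1 < e²` gives the contradiction. -/
theorem eventually_exists_lt_minModulus {f : ℂ → ℂ} (hf : Differentiable ℂ f) {k : ℝ → ℝ}
    (hM : ∀ᶠ r in atTop, Real.log (maxModulus f r) = Real.exp (Real.log r / 2 - k r)) {p : ℝ}
    (hp : 0 < p)
    (h1 : ∀ᶠ q in atTop, k (Real.exp (p * q)) - k (Real.exp (Real.exp q)) ≤ -2)
    (h2 : ∀ᶠ q in atTop, (1 - p / 2) * q + k (Real.exp (p * q)) ≤ -2) :
    ∀ᶠ R : ℝ in atTop, ∃ s ∈ Set.Icc 0 R, R < minModulus f s := by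
  have hpq : Tendsto (fun q : ℝ => p * q) atTop atTop := tendsto_id.const_mul_atTop hp
  have hmain : ∀ᶠ q : ℝ in atTop,
      ∃ s ∈ Set.Icc 0 (Real.exp (Real.exp q)), Real.exp (Real.exp q) < minModulus f s := by
    have hlt : ∀ᶠ q : ℝ in atTop, p * q < Real.exp q := by
      filter_upwards [(Real.tendsto_exp_div_pow_atTop 1).eventually_gt_atTop p,
        eventually_gt_atTop 0] with q hq hq0
      rwa [pow_one, lt_div_iff₀ hq0] at hq
    filter_upwards [h1, h2, hlt, (Real.tendsto_exp_atTop.comp hpq).eventually hM,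
      (Real.tendsto_exp_atTop.comp Real.tendsto_exp_atTop).eventually hM] with q h1 h2 hlt hMs hMR
    simp only [Function.comp_apply, Real.log_exp] at hMs hMR
    by_contra! hcon
    have hone : ∀ {r : ℝ}, 0 ≤ r → 0 < Real.log (maxModulus f r) → 1 < maxModulus f r := by
      intro r hr hlog
      obtain ⟨z, -, hz⟩ := exists_norm_eq_maxModulus hf.continuous hr
      exact (Real.log_pos_iff (hz ▸ norm_nonneg _)).mp hlog
    have hR := hone (Real.exp_pos _).le (hMR ▸ Real.exp_pos _)
    have hs := hone (Real.exp_pos _).le (hMs ▸ Real.exp_pos _)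
    have key := log_maxModulus_le hf (Real.one_le_exp (Real.exp_pos q).le)
      (Real.exp_pos (p * q)).le (Real.exp_lt_exp.mpr hlt) hR.le (by linarith)
      fun t ht htR => hcon t ⟨ht, htR.le⟩
    rw [hMs, hMR, Real.log_exp, ← Real.exp_sub, ← Real.exp_half, mul_assoc, ← Real.exp_add] at key
    set X := p * q / 2 - k (Real.exp (p * q)) with hX
    have e1 : (p * q - Real.exp q) / 2 + (Real.exp q / 2 - k (Real.exp (Real.exp q))) ≤ X - 2 := by
      rw [hX]; linarith
    have e2 : q ≤ X - 2 := by rw [hX]; linarith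
    have e3 := Real.exp_le_exp.mpr e1
    have e4 := Real.exp_le_exp.mpr e2
    have e5 : Real.exp X = Real.exp (X - 2) * Real.exp 2 := by rw [← Real.exp_add]; ring_nf
    have e6 : (2 : ℝ) + 1 < Real.exp 2 := Real.add_one_lt_exp (by norm_num)
    nlinarith [Real.exp_pos (X - 2)]
  have hloglog : Tendsto (fun R : ℝ => Real.log (Real.log R)) atTop atTop :=
    Real.tendsto_log_atTop.comp Real.tendsto_log_atTop
  filter_upwards [hloglog.eventually hmain, eventually_gt_atTop 1] with R hR hR1
  rwa [Real.exp_log (Real.log_pos hR1), Real.exp_log (by linarith)] at hR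

theorem eventually_const_mul_le_neg_two {c : ℝ} (hc : c < 0) :
    ∀ᶠ q : ℝ in atTop, c * q ≤ -2 :=
  (tendsto_id.const_mul_atTop_of_neg hc).eventually_le_atBot (-2)

theorem theorem2p2 (f : ℂ → ℂ) (hf : IsTranscendentalEntire f) (hf' : IsOrderHalfMinimalType f)
    (ε k : ℝ → ℝ)
    (hε : ∀ᶠ r in atTop, Real.log (maxModulus f r) = r ^ (1 / 2 - ε r))
    (hk : ∀ r : ℝ, 0 < r → k r = ε r * Real.log r)
    (h : (∃ δ C r₁ : ℝ, 0 < δ ∧ δ < 1 / 2 ∧ 1 < C ∧ 0 < r₁ ∧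
            ∀ r : ℝ, r₁ < r → k r ≤ δ * Real.log r ∧
              C * (δ / (1 / 2 - δ)) * Real.log (Real.log r) ≤ k r) ∨
         (Tendsto ε atTop (𝓝 0) ∧ ∃ C d r₂ : ℝ, 1 < C ∧ 1 < d ∧ 0 < r₂ ∧
            ∀ r : ℝ, r₂ < r → C * k ((Real.log r) ^ (2 * d)) ≤ k r)) :
    ∃ r : ℝ, 0 < r ∧ Tendsto (fun n : ℕ => (minModulus f)^[n] r) atTop atTop := by
  have hM : ∀ᶠ r in atTop,
      Real.log (maxModulus f r) = Real.exp (Real.log r / 2 - k r) := by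
    filter_upwards [hε, eventually_gt_atTop 0] with r hr hr0
    rw [hr, Real.rpow_def_of_pos hr0, hk r hr0]
    ring_nf
  have hexp (p : ℝ) (hp : 0 < p) : Tendsto (fun q : ℝ => Real.exp (p * q)) atTop atTop :=
    Real.tendsto_exp_atTop.comp (tendsto_id.const_mul_atTop hp)
  have hexp2 : Tendsto (fun q : ℝ => Real.exp (Real.exp q)) atTop atTop :=
    Real.tendsto_exp_atTop.comp Real.tendsto_exp_atTop
  refine exists_tendsto_iterate_minModulus hf.1.continuous ?_
  rcases h with ⟨δ, C, r₁, hδ, hδ', hC, -, h⟩ | ⟨hε0, C, d, r₂, hC, hd, -, h⟩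
  · have hδ2 : 0 < 1 / 2 - δ := by linarith
    -- Any `p` strictly between `1/(1/2 - δ)` and `C/(1/2 - δ)` works: the lower end makes `s^{1/2 -
    -- δ}` dominate `log R`, the upper end makes `k(R) - k(s)` tend to infinity.
    set p : ℝ := (1 + C) / 2 / (1 / 2 - δ) with hp
    have hp0 : 0 < p := by positivity
    have hpδ : p * (1 / 2 - δ) = (1 + C) / 2 := div_mul_cancel₀ _ hδ2.ne'
    have hpC : p < C / (1 / 2 - δ) := by
      rw [hp]
      gcongr
      linarith
    refine eventually_exists_lt_minModulus hf.1 hM hp0 ?_ ?_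
    · filter_upwards [(hexp p hp0).eventually_gt_atTop r₁, hexp2.eventually_gt_atTop r₁,
        eventually_const_mul_le_neg_two (c := δ * (p - C / (1 / 2 - δ)))
          (mul_neg_of_pos_of_neg hδ (by linarith))] with q hs hR hq
      have a1 := (h _ hs).1
      have a2 := (h _ hR).2
      rw [Real.log_exp] at a1
      rw [Real.log_exp, Real.log_exp] at a2
      have : C * (δ / (1 / 2 - δ)) = δ * (C / (1 / 2 - δ)) := by ring
      rw [this] at a2
      linarith
    · filter_upwards [(hexp p hp0).eventually_gt_atTop r₁,
        eventually_const_mul_le_neg_two (c := (1 - C) / 2) (by linarith)] with q hs hq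
      have a1 := (h _ hs).1
      rw [Real.log_exp] at a1
      have : (1 - C) / 2 = 1 - p * (1 / 2 - δ) := by rw [hpδ]; ring
      rw [this] at hq
      linarith
  · have hd0 : 0 < 2 * d := by linarith
    -- Minimal type says exactly that `e^{-k(r)} → 0`. Hence `k(R) - k(s) ≥ (C - 1) k(s)` is
    -- eventually large.
    have hktop : Tendsto k atTop atTop := by
      rw [← tendsto_neg_atBot_iff, ← Real.tendsto_exp_comp_nhds_zero]
      refine hf'.2.congr' ?_
      filter_upwards [hM, eventually_gt_atTop 0] with r hr hr0
      rw [hr, Real.rpow_def_of_pos hr0, ← Real.exp_sub]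
      ring_nf
    refine eventually_exists_lt_minModulus hf.1 hM hd0 ?_ ?_
    · filter_upwards [hexp2.eventually_gt_atTop r₂,
        (hktop.comp (hexp _ hd0)).eventually (eventually_const_mul_le_neg_two (c := 1 - C)
          (by linarith))] with q hR hq
      have a := h _ hR
      rw [Real.log_exp, ← Real.exp_mul, mul_comm q] at a
      simp only [Function.comp_apply] at hq
      linarith
    -- For `ε ≤ (d - 1)/(4d)`, `log M(s) = (log R)^{2d(1/2 - ε)}` has exponent at least `(d + 1)/2 >
    -- 1`.
    · filter_upwards [((hε0.comp (hexp _ hd0)).eventually_le_const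
          (u := (d - 1) / (4 * d)) (by have : 0 < d - 1 := by linarith
                                       positivity)), eventually_ge_atTop 0,
        eventually_const_mul_le_neg_two (c := (1 - d) / 2) (by linarith)] with q hq hq0 hq1
      rw [hk _ (Real.exp_pos _), Real.log_exp]
      simp only [Function.comp_apply] at hq
      rw [le_div_iff₀ (by linarith)] at hq
      nlinarith [mul_le_mul_of_nonneg_right hq hq0]
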